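/- Let $1\le b\le n$ and let $n$ workers (arms) have response times $X_i^y$ ($i\in\{1,\dots,n\}$, iterations $y\ge 1$) that are independent, with $X_i^y$ exponential of rate $\lambda_i$ and mean $\mu_i=1/\lambda_i$, where $\lambda_{\min}=\min_i\lambda_i\ge 1$. Let $0=T_0\le T_1\le\dots\le T_b$ be deterministic switching points; round $r\in\{1,\dots,b\}$ consists of the iterations $T_{r-1}<y\le T_r$. For a set (superarm) $\mathcal A$ of workers let $Z^y_{\mathcal A}=\max_{i\in\mathcal A}X_i^y$ and $\mu_{\mathcal A}=\mathbb E[Z^y_{\mathcal A}]$. Let $\mathcal A^{r,\star}$ and $\mathcal A^{r}_{\mathrm{worst}}$ consist of the $r$ workers with the smallest and the largest means, respectively, and put $\Delta_{\mathcal A^r,\max}=\mu_{\mathcal A^r_{\mathrm{worst}}}-\mu_{\mathcal A^{r,\star}}$. Writing $\mathcal A_\nu$ for the $\nu$-th fastest worker of $\mathcal A$, let $$\delta_{\min}=\min\bigl\{\mu_{\mathcal A_\nu}-\mu_{\mathcal A^{r,\star}_\nu} \;:\; 1\le\nu\le r\le b,\ |\mathcal A|=r,\ \mu_{\mathcal A_\nu}>\mu_{\mathcal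 A^{r,\star}_\nu}\bigr\}$$ (if all $\mu_i$ are equal, this set is empty, all $\Delta_{\mathcal A^r,\max}$ vanish, and the bound below is read as $0$). Consider a policy that in each iteration $y$ of round $r$ employs a superarm $\mathcal A(y)$ of $r$ workers with the lowest lower confidence bounds $$\mathrm{LCB}_i(y-1)=\begin{cases}-\infty,& T_i(y-1)=0,\\ \hat\mu_i(y-1)-\sqrt{\dfrac{4f(y-1)}{T_i(y-1)}}-\dfrac{2f(y-1)}{T_i(y-1)},&\text{otherwise,}\end{cases}\qquad f(y)=2\log y,$$ where $T_i(y)$ is the number of iterations up to $y$ in which worker $i$ was employed and $\hat\mu_i(y)$ is the average of its response times in those iterations. Ties are broken arbitrarily, without knowledge of the response times of iteration $y$ or later. For $1\le j\le T_b$ the total run-time $\sum_{y=1}^jZ^y_{\mathcal A(y)}$ is integrable, and the regret $$R_j=\mathbb E\Bigl[\sum_{y=1}^{j}Z^y_{\mathcal A(y)}\Bigr]-\sum_{r\in\{1,\dots,b\}:\,j>T_{r-1}}\bigl(\min\{j,T_r\}-T_{r-1}\bigr)\min_{|\mathcal A|=r}\mu_{\mathcal A}$$ satisfies $$R_j\;\le\;\max_{r\in\{1,\dots,b\}:\,j>T_{r-1}}\Delta_{\mathcal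 A^{r},\max}\cdot n\cdot\left(\frac{48\log j}{\min\{\delta_{\min}^2,\delta_{\min}\}}+1+u\cdot\frac{\pi^2}{3}\right),\qquad u=\max\{r\in\{1,\dots,b\}: j>T_{r-1}\}.$$ -/

import Mathlib

open MeasureTheory ProbabilityTheory

noncomputable section

namespace CMAB

/-- Mean response time of worker `i`, whose response times are exponential with rate `lam i`. -/
def mean {n : ℕ} (lam : Fin n → ℝ) (i : Fin n) : ℝ := 1 / lam i

/-- Response time of a superarm `A` if worker `i` responds after time `x i`:
the maximum of `x i` over `i ∈ A` (and `0` for the empty superarm, which is never used). -/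
def responseTime {n : ℕ} (x : Fin n → ℝ) (A : Finset (Fin n)) : ℝ :=
  if h : A.Nonempty then A.sup' h x else 0

/-- Expected response time of a superarm: the expectation of the maximum of
independent exponential variables with rates `lam i`, `i ∈ A`. -/
def superarmMean {n : ℕ} (lam : Fin n → ℝ) (A : Finset (Fin n)) : ℝ :=
  ∫ x, responseTime x A ∂(Measure.pi fun i => expMeasure (lam i))

/-- Worker `i` comes before worker `k` in the order from fastest to slowest
(equal means are ordered by index). -/
def Faster {n : ℕ} (lam : Fin n → ℝ) (i k : Fin n) : Prop :=
  mean lam i < mean lam k ∨ (mean lam i = mean lam k ∧ i < k)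

open Classical in
/-- The superarm of the `r` fastest workers. -/
def fastest {n : ℕ} (lam : Fin n → ℝ) (r : ℕ) : Finset (Fin n) :=
  Finset.univ.filter fun i => (Finset.univ.filter fun k => Faster lam k i).card < r

open Classical in
/-- The superarm of the `r` slowest workers. -/
def slowest {n : ℕ} (lam : Fin n → ℝ) (r : ℕ) : Finset (Fin n) :=
  Finset.univ.filter fun i => (Finset.univ.filter fun k => Faster lam i k).card < r

open Classical in
/-- `i` is the `ν`-th fastest worker of the superarm `A` (`ν = 1` is the fastest one). -/
def IsNthFastest {n : ℕ} (lam : Fin n → ℝ) (A : Finset (Fin n)) (ν : ℕ) (i : Fin n) : Prop :=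
  i ∈ A ∧ (A.filter fun k => Faster lam k i).card + 1 = ν

/-- The largest suboptimality gap of a superarm of size `r`: slowest minus fastest superarm. -/
def superarmGapMax {n : ℕ} (lam : Fin n → ℝ) (r : ℕ) : ℝ :=
  superarmMean lam (slowest lam r) - superarmMean lam (fastest lam r)

/-- The positive gaps between the `ν`-th fastest worker of a superarm `A` of some size `r ≤ b`
and the `ν`-th fastest worker of the optimal superarm of size `r`. -/
def armGaps {n : ℕ} (lam : Fin n → ℝ) (b : ℕ) : Set ℝ :=
  {d | ∃ r ∈ Finset.Icc 1 b, ∃ A : Finset (Fin n), A.card = r ∧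
    ∃ ν ∈ Finset.Icc 1 r, ∃ i k : Fin n,
      IsNthFastest lam A ν i ∧ IsNthFastest lam (fastest lam r) ν k ∧
      mean lam k < mean lam i ∧ d = mean lam i - mean lam k}

/-- The minimum suboptimality gap `δ_min`: the minimum of the finite set `armGaps`.
(This set is empty only if all workers have the same mean; then all superarm gaps vanish.) -/
def gapMin {n : ℕ} (lam : Fin n → ℝ) (b : ℕ) : ℝ := sInf (armGaps lam b)

/-- The rounds `r ∈ [1, b]` with `j > T_{r-1}`, i.e. those started before or at iteration `j`. -/
def activeRounds (b : ℕ) (T : ℕ → ℕ) (j : ℕ) : Finset ℕ :=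
  (Finset.Icc 1 b).filter fun r => T (r - 1) < j

/-- The largest superarm gap in the rounds up to iteration `j`. -/
def maxSuperarmGap {n : ℕ} (lam : Fin n → ℝ) (b : ℕ) (T : ℕ → ℕ) (j : ℕ) : ℝ :=
  sSup (superarmGapMax lam '' (activeRounds b T j : Set ℕ))

/-- The largest superarm size used up to iteration `j`. -/
def maxActive (b : ℕ) (T : ℕ → ℕ) (j : ℕ) : ℕ := (activeRounds b T j).sup id

/-- The smallest expected response time of a superarm of size `r`. -/
def bestMean {n : ℕ} (lam : Fin n → ℝ) (r : ℕ) : ℝ :=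
  sInf (superarmMean lam '' {A : Finset (Fin n) | A.card = r})

section Dynamics

variable {Ω : Type*} {n : ℕ}

/-- Number of times worker `i` has been employed in iterations `1, …, j`. -/
def pullCount (A : ℕ → Ω → Finset (Fin n)) (i : Fin n) (j : ℕ) (ω : Ω) : ℕ :=
  ((Finset.Icc 1 j).filter fun y => i ∈ A y ω).card

/-- Sum of the response times of worker `i` in iterations `1, …, j`. -/
def respSum (X : ℕ → Fin n → Ω → ℝ) (A : ℕ → Ω → Finset (Fin n)) (i : Fin n) (j : ℕ) (ω : Ω) :
    ℝ :=
  ∑ y ∈ Finset.Icc 1 j, if i ∈ A y ω then X y i ω else 0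

/-- Empirical mean response time of worker `i` after iteration `j`. -/
def empMean (X : ℕ → Fin n → Ω → ℝ) (A : ℕ → Ω → Finset (Fin n)) (i : Fin n) (j : ℕ) (ω : Ω) :
    ℝ :=
  respSum X A i j ω / pullCount A i j ω

/-- Lower confidence bound of worker `i` after iteration `j`, for a confidence radius `rad`,
a function of the iteration and of the counter of the worker. -/
def lcb (rad : ℕ → ℕ → ℝ) (X : ℕ → Fin n → Ω → ℝ) (A : ℕ → Ω → Finset (Fin n))
    (i : Fin n) (j : ℕ) (ω : Ω) : EReal :=
  if pullCount A i j ω = 0 then ⊥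
  else ((empMean X A i j ω - rad j (pullCount A i j ω) : ℝ) : EReal)

/-- `X y i` is the response time of worker `i` in iteration `y ≥ 1`: all of them are independent,
exponential with rate `lam i`, known after iteration `y`, and independent of what is known before
it. Here `ℱ y` is the information available after iteration `y`; it may contain randomness of
the main node (for breaking ties) besides the response times. -/
structure IsResponseModel {mΩ : MeasurableSpace Ω} (P : Measure Ω) (ℱ : Filtration ℕ mΩ)
    (lam : Fin n → ℝ) (X : ℕ → Fin n → Ω → ℝ) : Prop where
  adapted : ∀ y i, Measurable[ℱ (y + 1)] (X (y + 1) i)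
  law : ∀ y i, P.map (X (y + 1) i) = expMeasure (lam i)
  indep : iIndepFun (fun p : ℕ × Fin n => X (p.1 + 1) p.2) P
  indep_past : ∀ y, Indep (ℱ y)
    (MeasurableSpace.comap (fun ω i => X (y + 1) i ω) MeasurableSpace.pi) P

/-- `A y` is the superarm pulled in iteration `y`, for `1 ≤ y ≤ T b`, by a policy that in each
iteration of round `r` employs `r` workers with the lowest lower confidence bounds, decided from
what is known before the iteration. Ties may be broken in any such way. -/
structure IsLCBPolicy {mΩ : MeasurableSpace Ω} (ℱ : Filtration ℕ mΩ) (b : ℕ) (T : ℕ → ℕ)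
    (rad : ℕ → ℕ → ℝ) (X : ℕ → Fin n → Ω → ℝ) (A : ℕ → Ω → Finset (Fin n)) : Prop where
  predictable : ∀ y < T b, ∀ S : Finset (Fin n), MeasurableSet[ℱ y] {ω | A (y + 1) ω = S}
  card_eq : ∀ r ∈ Finset.Icc 1 b, ∀ y, T (r - 1) < y → y ≤ T r → ∀ ω, (A y ω).card = r
  lowest : ∀ y < T b, ∀ ω, ∀ i ∈ A (y + 1) ω, ∀ k ∉ A (y + 1) ω,
    lcb rad X A i y ω ≤ lcb rad X A k y ω

/-- Run-time of the policy until the end of iteration `j`. -/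
def runTime (X : ℕ → Fin n → Ω → ℝ) (A : ℕ → Ω → Finset (Fin n)) (j : ℕ) (ω : Ω) : ℝ :=
  ∑ y ∈ Finset.Icc 1 j, responseTime (fun i => X y i ω) (A y ω)

/-- Regret until iteration `j`: expected run-time minus expected run-time of the optimal policy. -/
def regret {mΩ : MeasurableSpace Ω} (P : Measure Ω) (lam : Fin n → ℝ) (b : ℕ) (T : ℕ → ℕ)
    (X : ℕ → Fin n → Ω → ℝ) (A : ℕ → Ω → Finset (Fin n)) (j : ℕ) : ℝ :=
  (∫ ω, runTime X A j ω ∂P) -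
    ∑ r ∈ activeRounds b T j, (((min j (T r) : ℕ) : ℝ) - (T (r - 1) : ℝ)) * bestMean lam r

end Dynamics

/-- The exploration function `f(j) = 2 log j`. -/
def explore (j : ℕ) : ℝ := 2 * Real.log j

/-- The confidence radius after iteration `j` for a worker employed `s` times. -/
def confRadius (j s : ℕ) : ℝ := √(4 * explore j / s) + 2 * explore j / s

end CMAB

end

/-! The superarm of an iteration is chosen from the past, so given its choice its response time
averages to `superarmMean`. By a coupling, replacing a worker by one of no larger mean never raises
`superarmMean`. Hence the fastest and slowest superarms are extremal, and an iteration costs at most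
the largest gap `G` if its superarm is suboptimal (`IsSuboptimal`) and nothing otherwise. The regret
is therefore at most `G` times the expected number of suboptimal iterations.

If iteration `t + 1` is suboptimal, some employed `i` has a lower confidence bound no larger than
that of a strictly faster unemployed `k`. By `not_lcb_le_lcb` this forces either `i` to have been
employed fewer than `m` times, where `m` is about `48 log j / δ²`, or the empirical mean of `i` or
`k` to deviate. The first kind occurs at most `n * m` times, because each occurrence raises one of
the small counters. For the second kind, each worker deviates with probability at most `2 / t²`, and
these sum to at most `π² / 3` per worker (`sum_measure_isSuboptimal_le`).

The deviation bound is a Chernoff bound at a random sample size. For fixed tilt parameters the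
exponential process of a worker is a supermartingale under predictable sampling
(`lintegral_exp_respSum_le_one`). A union bound over the counter values then allows a separate tilt
for each value. -/

namespace CMAB

/-! ### Ranks in finite strict linear orders. -/

section Order

variable {α : Type*} [Fintype α]

open Classical in
/-- In a finite strict linear order, exactly `r` elements have fewer than `r` predecessors. -/
theorem card_filter_card_pred_lt (R : α → α → Prop) (hirr : ∀ i, ¬ R i i)
    (htrans : ∀ i j k, R i j → R j k → R i k) (htot : ∀ i j, i ≠ j → R i j ∨ R j i)
    {r : ℕ} (hr : r ≤ Fintype.card α) :
    (Finset.univ.filter fun i => (Finset.univ.filter fun k => R k i).card < r).card = r := by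
  set rank : α → ℕ := fun i => (Finset.univ.filter fun k => R k i).card with hrank
  have hlt : ∀ i, rank i < Fintype.card α := fun i =>
    Finset.card_lt_univ_of_notMem (x := i) (by simp [hirr])
  have hmono : ∀ i k, R i k → rank i < rank k := fun i k h =>
    Finset.card_lt_card (Finset.ssubset_iff_of_subset
      (fun m hm => by simpa using htrans _ _ _ (by simpa using hm) h) |>.2
        ⟨i, by simpa using h, by simp [hirr]⟩)
  have hinj : Function.Injective rank := by
    intro i k h
    by_contra hne
    rcases htot i k hne with h' | h'
    · exact (hmono _ _ h').ne h
    · exact (hmono _ _ h').ne' h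
  -- Injective ranks, all below the cardinality, must exhaust the range.
  have himg : Finset.univ.image rank = Finset.range (Fintype.card α) :=
    Finset.eq_of_subset_of_card_le
      (fun m hm => by
        obtain ⟨i, -, rfl⟩ := Finset.mem_image.1 hm
        exact Finset.mem_range.2 (hlt i))
      (by rw [Finset.card_image_of_injective _ hinj]; simp)
  have : (Finset.univ.filter fun i => rank i < r).image rank = Finset.range r := by
    ext m
    simp only [Finset.mem_image, Finset.mem_filter, Finset.mem_univ, true_and, Finset.mem_range]
    constructor
    · rintro ⟨i, hi, rfl⟩; exact hi
    · intro hm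
      have : m ∈ Finset.univ.image rank := by
        rw [himg]; exact Finset.mem_range.2 (hm.trans_le hr)
      obtain ⟨i, -, rfl⟩ := Finset.mem_image.1 this
      exact ⟨i, hm, rfl⟩
  rw [← Finset.card_image_of_injective _ hinj, this, Finset.card_range]

open Classical in
theorem rel_of_card_pred_lt (R : α → α → Prop)
    (htrans : ∀ i j k, R i j → R j k → R i k) (htot : ∀ i j, i ≠ j → R i j ∨ R j i)
    {r : ℕ} {i k : α} (hk : (Finset.univ.filter fun m => R m k).card < r)
    (hi : ¬ (Finset.univ.filter fun m => R m i).card < r) : R k i := by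
  rcases eq_or_ne k i with rfl | hne
  · exact absurd hk hi
  rcases htot k i hne with h | h
  · exact h
  · exact absurd ((Finset.card_le_card fun m hm => by
      simpa using htrans _ _ _ (by simpa using hm) h).trans_lt hk) hi

end Order

/-! ### The order of the workers and the arm gaps. -/

variable {n : ℕ} {lam : Fin n → ℝ}

theorem Faster.irrefl (i : Fin n) : ¬ Faster lam i i := by simp [Faster]

theorem Faster.trans (i j k : Fin n) (h₁ : Faster lam i j) (h₂ : Faster lam j k) :
    Faster lam i k := by
  unfold Faster at *
  rcases h₁ with h₁ | ⟨h₁, h₁'⟩ <;> rcases h₂ with h₂ | ⟨h₂, h₂'⟩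
  · exact Or.inl (h₁.trans h₂)
  · exact Or.inl (h₂ ▸ h₁)
  · exact Or.inl (h₁ ▸ h₂)
  · exact Or.inr ⟨h₁.trans h₂, h₁'.trans h₂'⟩

theorem Faster.total (i j : Fin n) (h : i ≠ j) : Faster lam i j ∨ Faster lam j i := by
  unfold Faster
  rcases lt_trichotomy (mean lam i) (mean lam j) with h' | h' | h'
  · simp [h']
  · rcases lt_or_gt_of_ne h with h'' | h'' <;> simp [h', h'']
  · simp [h']

theorem Faster.mean_le {i k : Fin n} (h : Faster lam i k) : mean lam i ≤ mean lam k := by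
  rcases h with h | h
  · exact h.le
  · exact h.1.le

theorem card_fastest {r : ℕ} (hr : r ≤ n) : (fastest lam r).card = r :=
  card_filter_card_pred_lt (Faster lam) Faster.irrefl Faster.trans Faster.total (by simpa)

theorem card_slowest {r : ℕ} (hr : r ≤ n) : (slowest lam r).card = r :=
  card_filter_card_pred_lt (fun i k => Faster lam k i) Faster.irrefl
    (fun _ _ _ h₁ h₂ => Faster.trans _ _ _ h₂ h₁) (fun i k h => (Faster.total i k h).symm)
    (by simpa)

theorem mean_le_of_mem_fastest {r : ℕ} {i k : Fin n} (hk : k ∈ fastest lam r)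
    (hi : i ∉ fastest lam r) : mean lam k ≤ mean lam i := by
  simp only [fastest, Finset.mem_filter, Finset.mem_univ, true_and] at hk hi
  exact Faster.mean_le (rel_of_card_pred_lt (Faster lam) Faster.trans Faster.total hk hi)

theorem mean_le_of_mem_slowest {r : ℕ} {i k : Fin n} (hk : k ∈ slowest lam r)
    (hi : i ∉ slowest lam r) : mean lam i ≤ mean lam k := by
  simp only [slowest, Finset.mem_filter, Finset.mem_univ, true_and] at hk hi
  exact Faster.mean_le (rel_of_card_pred_lt (fun i k => Faster lam k i)
    (fun _ _ _ h₁ h₂ => Faster.trans _ _ _ h₂ h₁) (fun i k h => (Faster.total i k h).symm) hk hi)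

/-- The gap between any worker and a strictly faster one among the `b` fastest is an arm gap. -/
theorem sub_mem_armGaps {b : ℕ} {i k : Fin n} (hk : k ∈ fastest lam b)
    (hik : mean lam k < mean lam i) : mean lam i - mean lam k ∈ armGaps lam b := by
  classical
  set B := Finset.univ.filter fun m => Faster lam m k with hB
  have hki : Faster lam k i := Or.inl hik
  have hiB : i ∉ B := fun h =>
    Faster.irrefl k (Faster.trans _ _ _ hki (Finset.mem_filter.1 h).2)
  have hkb : B.card < b := by
    simp only [fastest, Finset.mem_filter, Finset.mem_univ, true_and] at hk
    convert hk
  -- With `B` the predecessors of `k`, worker `i` is last in `insert i B`, and `k` is last in the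
  -- fastest superarm of the same size.
  refine ⟨B.card + 1, by simp; omega, insert i B, Finset.card_insert_of_notMem hiB,
    B.card + 1, by simp, i, k, ⟨Finset.mem_insert_self _ _, ?_⟩, ⟨?_, ?_⟩, hik, rfl⟩
  · congr 2
    ext m
    simp only [Finset.mem_filter, Finset.mem_insert, hB, Finset.mem_univ, true_and]
    constructor
    · rintro ⟨rfl | h, h'⟩
      · exact absurd h' (Faster.irrefl _)
      · exact h
    · exact fun h => ⟨Or.inr h, Faster.trans _ _ _ h hki⟩
  · simp only [fastest, Finset.mem_filter, Finset.mem_univ, true_and]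
    convert Nat.lt_succ_self B.card
  · congr 2
    ext m
    simp only [Finset.mem_filter, hB, Finset.mem_univ, true_and, and_iff_right_iff_imp]
    intro h
    simp only [fastest, Finset.mem_filter, Finset.mem_univ, true_and]
    refine Nat.lt_succ_of_le (Finset.card_le_card fun l hl => ?_)
    simp only [Finset.mem_filter, Finset.mem_univ, true_and] at hl ⊢
    exact Faster.trans _ _ _ hl h

theorem armGaps_finite (b : ℕ) : (armGaps lam b).Finite :=
  (Set.finite_range fun p : Fin n × Fin n => mean lam p.1 - mean lam p.2).subset
    fun _ ⟨_, _, _, _, _, _, i, k, _, _, _, h⟩ => ⟨(i, k), h.symm⟩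

theorem gapMin_le {b : ℕ} {i k : Fin n} (hk : k ∈ fastest lam b)
    (hik : mean lam k < mean lam i) : gapMin lam b ≤ mean lam i - mean lam k :=
  csInf_le (armGaps_finite b).bddBelow (sub_mem_armGaps hk hik)

theorem gapMin_pos {b : ℕ} {i k : Fin n} (hk : k ∈ fastest lam b)
    (hik : mean lam k < mean lam i) : 0 < gapMin lam b := by
  have hne : (armGaps lam b).Nonempty := ⟨_, sub_mem_armGaps hk hik⟩
  obtain ⟨_, _, _, _, _, _, _, _, _, _, h, h'⟩ := hne.csInf_mem (armGaps_finite b)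
  unfold gapMin
  rw [h']
  exact sub_pos.2 h

/-- This includes the case of equal means, where the infimum of the empty set is `0`. -/
theorem gapMin_nonneg (b : ℕ) : 0 ≤ gapMin lam b := by
  refine Real.sInf_nonneg ?_
  rintro _ ⟨_, _, _, _, _, _, _, _, _, _, h, rfl⟩
  exact (sub_pos.2 h).le

theorem fastest_mono {r b : ℕ} (h : r ≤ b) : fastest lam r ⊆ fastest lam b := by
  intro i
  simp only [fastest, Finset.mem_filter, Finset.mem_univ, true_and]
  exact fun hi => hi.trans_le h

end CMAB

namespace CMAB

/-! ### Scaling, moment generating function and integrability of exponential laws. -/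

section Exponential

/-- Scaling lets i.i.d. standard exponentials drive all workers at once, which is the basis of the
coupling. -/
theorem map_div_expMeasure_one {r : ℝ} (hr : 0 < r) :
    (expMeasure 1).map (fun x => x / r) = expMeasure r := by
  have := isProbabilityMeasure_expMeasure hr
  have := isProbabilityMeasure_expMeasure one_pos
  have hm : Measurable fun x : ℝ => x / r := by fun_prop
  have : IsProbabilityMeasure ((expMeasure 1).map (fun x => x / r)) :=
    Measure.isProbabilityMeasure_map hm.aemeasurable
  refine Measure.eq_of_cdf _ _ ?_
  ext x
  have hpre : (fun x : ℝ => x / r) ⁻¹' Set.Iic x = Set.Iic (r * x) := by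
    ext t; simp [div_le_iff₀ hr, mul_comm]
  rw [cdf_eq_real, map_measureReal_apply hm measurableSet_Iic, hpre, ← cdf_eq_real,
    cdf_expMeasure_eq one_pos, cdf_expMeasure_eq hr]
  simp [mul_nonneg_iff_of_pos_left hr]

/-- Exponential tilting: the moment generating function of the exponential distribution. -/
theorem lintegral_exp_mul_expMeasure {r θ : ℝ} (hr : 0 < r) (hθ : θ < r) :
    ∫⁻ x, ENNReal.ofReal (Real.exp (θ * x)) ∂(expMeasure r) = ENNReal.ofReal (r / (r - θ)) := by
  have hpos : 0 < r - θ := sub_pos.2 hθ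
  have hm : Measurable (exponentialPDF r) :=
    (measurable_exponentialPDFReal r).ennreal_ofReal
  change ∫⁻ x, _ ∂((volume : Measure ℝ).withDensity (exponentialPDF r)) = _
  rw [lintegral_withDensity_eq_lintegral_mul _ hm (by fun_prop)]
  have : ∀ x, (exponentialPDF r * fun x => ENNReal.ofReal (Real.exp (θ * x))) x
      = ENNReal.ofReal (r / (r - θ)) * exponentialPDF (r - θ) x := by
    intro x
    simp only [Pi.mul_apply]
    rcases lt_or_ge x 0 with hx | hx
    · simp [exponentialPDF_of_neg hx]
    · rw [exponentialPDF_of_nonneg hx, exponentialPDF_of_nonneg hx,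
        ← ENNReal.ofReal_mul (by positivity), ← ENNReal.ofReal_mul (by positivity)]
      congr 1
      rw [mul_assoc, ← Real.exp_add, ← mul_assoc, div_mul_cancel₀ _ hpos.ne']
      congr 2
      ring
  simp_rw [this]
  have hm' : Measurable (exponentialPDF (r - θ)) :=
    (measurable_exponentialPDFReal _).ennreal_ofReal
  rw [lintegral_const_mul _ hm',
    lintegral_exponentialPDF_eq_one hpos, mul_one]

theorem ae_nonneg_expMeasure (r : ℝ) : ∀ᵐ x ∂(expMeasure r), 0 ≤ x := by
  change ∀ᵐ x ∂((volume : Measure ℝ).withDensity (exponentialPDF r)), 0 ≤ x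
  have hm : Measurable (exponentialPDF r) :=
    (measurable_exponentialPDFReal r).ennreal_ofReal
  rw [ae_withDensity_iff hm]
  refine ae_of_all _ fun x hx => ?_
  by_contra h
  exact hx (exponentialPDF_of_neg (not_le.1 h))

theorem integrable_id_expMeasure {r : ℝ} (hr : 0 < r) :
    Integrable (fun x : ℝ => x) (expMeasure r) := by
  have hint : Integrable (fun x : ℝ => Real.exp (r / 2 * x)) (expMeasure r) := by
    refine ⟨by fun_prop, ?_⟩
    rw [hasFiniteIntegral_iff_ofReal (ae_of_all _ fun x => (Real.exp_pos _).le),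
      lintegral_exp_mul_expMeasure hr (by linarith)]
    exact ENNReal.ofReal_lt_top
  refine (hint.const_mul (2 / r)).mono' (by fun_prop) ?_
  filter_upwards [ae_nonneg_expMeasure r] with x hx
  rw [Real.norm_of_nonneg hx]
  have h := Real.add_one_le_exp (r / 2 * x)
  calc x = 2 / r * (r / 2 * x) := by field_simp
    _ ≤ 2 / r * Real.exp (r / 2 * x) := by gcongr; linarith

end Exponential

/-! ### Comparison of expected response times of superarms. -/

section ResponseTime

variable {n : ℕ}

theorem responseTime_le_of_forall {A B : Finset (Fin n)} {x y : Fin n → ℝ} (hA : A.Nonempty)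
    (h : ∀ i ∈ A, ∃ k ∈ B, x i ≤ y k) : responseTime x A ≤ responseTime y B := by
  obtain ⟨k, hk, -⟩ := h _ hA.choose_spec
  have hB : B.Nonempty := ⟨k, hk⟩
  rw [responseTime, responseTime, dif_pos hA, dif_pos hB]
  refine Finset.sup'_le _ _ fun i hi => ?_
  obtain ⟨k, hk, hik⟩ := h i hi
  exact hik.trans (Finset.le_sup' y hk)

theorem abs_responseTime_le (x : Fin n → ℝ) (A : Finset (Fin n)) :
    |responseTime x A| ≤ ∑ i, |x i| := by
  unfold responseTime
  split_ifs with h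
  · obtain ⟨i, -, hi⟩ := Finset.exists_mem_eq_sup' h x
    rw [hi]
    exact Finset.single_le_sum (f := fun i => |x i|) (fun _ _ => abs_nonneg _)
      (Finset.mem_univ i)
  · simp only [abs_zero]
    exact Finset.sum_nonneg fun _ _ => abs_nonneg _

theorem measurable_responseTime (A : Finset (Fin n)) :
    Measurable fun x : Fin n → ℝ => responseTime x A := by
  unfold responseTime
  split_ifs with h
  · have := Finset.measurable_sup' h (f := fun i (x : Fin n → ℝ) => x i)
      fun i _ => measurable_pi_apply i
    convert this using 1
    ext x
    simp
  · exact measurable_const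

theorem integrable_responseTime {Ω : Type*} {mΩ : MeasurableSpace Ω} {P : Measure Ω}
    {x : Fin n → Ω → ℝ} (hm : ∀ i, Measurable (x i)) (hx : ∀ i, Integrable (x i) P)
    (A : Finset (Fin n)) :
    Integrable (fun ω => responseTime (fun i => x i ω) A) P := by
  refine (integrable_finsetSum Finset.univ fun i _ => (hx i).norm).mono'
    ((measurable_responseTime A).comp (measurable_pi_lambda _ hm)).aestronglyMeasurable
    (ae_of_all _ fun ω => ?_)
  exact abs_responseTime_le _ A

variable {lam : Fin n → ℝ}

/-- The expected response time, with all workers driven by standard exponential variables. -/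
theorem superarmMean_eq_integral_div (hlam : ∀ i, 0 < lam i) (A : Finset (Fin n)) :
    superarmMean lam A =
      ∫ x, responseTime (fun i => x i / lam i) A ∂(Measure.pi fun _ : Fin n => expMeasure 1) := by
  have := isProbabilityMeasure_expMeasure one_pos
  have := fun i => isProbabilityMeasure_expMeasure (hlam i)
  have hmap : (Measure.pi fun _ : Fin n => expMeasure 1).map (fun x i => x i / lam i)
      = Measure.pi fun i => expMeasure (lam i) := by
    have : ∀ i, SigmaFinite ((expMeasure 1).map (fun x => x / lam i)) := fun i => by
      rw [map_div_expMeasure_one (hlam i)]; infer_instance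
    rw [Measure.pi_map_pi (f := fun i x => x / lam i) (fun i => by fun_prop)]
    simp_rw [map_div_expMeasure_one (hlam _)]
  unfold superarmMean
  have hm : Measurable fun (x : Fin n → ℝ) i => x i / lam i := by fun_prop
  rw [← hmap, integral_map hm.aemeasurable (measurable_responseTime A).aestronglyMeasurable]

theorem integral_pi_comp_perm {ι E : Type*} [Fintype ι] [NormedAddCommGroup E] [NormedSpace ℝ E]
    (μ : Measure ℝ) [SigmaFinite μ] (σ : Equiv.Perm ι) (f : (ι → ℝ) → E) :
    ∫ x, f (fun i => x (σ i)) ∂(Measure.pi fun _ : ι => μ) =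
      ∫ x, f x ∂(Measure.pi fun _ : ι => μ) := by
  have h := measurePreserving_piCongrLeft (fun _ : ι => μ) σ.symm
  have happ : ∀ x : ι → ℝ,
      MeasurableEquiv.piCongrLeft (fun _ => ℝ) σ.symm x = fun i => x (σ i) := by
    intro x
    funext m
    have := Equiv.piCongrLeft_apply_apply (fun _ : ι => ℝ) σ.symm x (σ m)
    rwa [Equiv.symm_apply_apply] at this
  calc _ = ∫ x, f (MeasurableEquiv.piCongrLeft (fun _ => ℝ) σ.symm x)
        ∂(Measure.pi fun _ : ι => μ) := by simp_rw [happ]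
    _ = _ := h.integral_comp' f

theorem integrable_responseTime_div {ν : Measure (Fin n → ℝ)}
    (h : ∀ m : Fin n, Integrable (fun x : Fin n → ℝ => x m) ν) (σ : Fin n → Fin n)
    (A : Finset (Fin n)) :
    Integrable (fun x => responseTime (fun m => x (σ m) / lam m) A) ν := by
  have h₁ : ∀ m : Fin n, Measurable fun x : Fin n → ℝ => x (σ m) / lam m := fun m => by fun_prop
  have h₂ : ∀ m : Fin n, Integrable (fun x : Fin n → ℝ => x (σ m) / lam m) ν := by
    intro m
    simp_rw [div_eq_mul_inv]
    exact (h (σ m)).mul_const _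
  exact integrable_responseTime h₁ h₂ A

/-- Replacing a worker by one whose mean is no larger does not slow down a superarm. -/
theorem superarmMean_insert_erase_le (hlam : ∀ i, 0 < lam i) {A : Finset (Fin n)} {i k : Fin n}
    (hi : i ∈ A) (hk : k ∉ A) (hki : mean lam k ≤ mean lam i) :
    superarmMean lam (insert k (A.erase i)) ≤ superarmMean lam A := by
  have := isProbabilityMeasure_expMeasure one_pos
  set ν := Measure.pi fun _ : Fin n => expMeasure 1 with hν
  have hcoord : ∀ m : Fin n, Integrable (fun x : Fin n → ℝ => x m) ν := fun m =>
    integrable_comp_eval (μ := fun _ : Fin n => expMeasure 1) (i := m) (f := fun x : ℝ => x)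
      (integrable_id_expMeasure one_pos)
  have hnn : ∀ᵐ x ∂ν, 0 ≤ x i := by
    have hmp := measurePreserving_eval (fun _ : Fin n => expMeasure 1) i
    exact hmp.quasiMeasurePreserving.ae (ae_nonneg_expMeasure 1)
  rw [superarmMean_eq_integral_div hlam, superarmMean_eq_integral_div hlam]
  -- The coupling: after the swap, the incoming worker `k` is driven by the exponential variable
  -- that drives `i` in `A`, so its response time is pointwise no larger.
  rw [← integral_pi_comp_perm (expMeasure 1) (Equiv.swap i k)]
  have hint : ∀ (σ : Fin n → Fin n) (B : Finset (Fin n)),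
      Integrable (fun x => responseTime (fun m => x (σ m) / lam m) B) ν := fun σ B =>
    integrable_responseTime_div hcoord σ B
  refine integral_mono_ae (hint (Equiv.swap i k) _) (hint id A) ?_
  filter_upwards [hnn] with x hx
  refine responseTime_le_of_forall (Finset.insert_nonempty _ _) fun m hm => ?_
  rcases Finset.mem_insert.1 hm with rfl | hm
  · refine ⟨i, hi, ?_⟩
    rw [Equiv.swap_apply_right, div_eq_mul_one_div, div_eq_mul_one_div (x i)]
    exact mul_le_mul_of_nonneg_left hki hx
  · obtain ⟨hmi, hmA⟩ := Finset.mem_erase.1 hm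
    refine ⟨m, hmA, ?_⟩
    rw [Equiv.swap_apply_of_ne_of_ne hmi (by rintro rfl; exact hk hmA)]

/-- Exchange argument: members of `A \ B` are traded one at a time for members of `B \ A`, and no
trade increases the mean. The induction is on the size of `A \ B`. -/
theorem superarmMean_le_of_forall_mean_le (hlam : ∀ i, 0 < lam i) {A B : Finset (Fin n)}
    (hcard : A.card = B.card)
    (h : ∀ i ∈ A, i ∉ B → ∀ k ∈ B, k ∉ A → mean lam k ≤ mean lam i) :
    superarmMean lam B ≤ superarmMean lam A := by
  induction hd : (A \ B).card generalizing A with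
  | zero =>
    have : A ⊆ B := by simpa [Finset.sdiff_eq_empty_iff_subset] using hd
    rw [Finset.eq_of_subset_of_card_le this hcard.ge]
  | succ d ih =>
    obtain ⟨i, hi⟩ : (A \ B).Nonempty := Finset.card_pos.1 (by omega)
    obtain ⟨k, hk⟩ : (B \ A).Nonempty := by
      rw [← Finset.card_pos, ← Finset.card_sdiff_comm hcard]; omega
    rw [Finset.mem_sdiff] at hi hk
    refine le_trans (ih (A := insert k (A.erase i)) ?_ ?_ ?_)
      (superarmMean_insert_erase_le hlam hi.1 hk.2 (h i hi.1 hi.2 k hk.1 hk.2))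
    · rw [Finset.card_insert_of_notMem (by simp [hk.2]), Finset.card_erase_of_mem hi.1, ← hcard]
      have := Finset.card_pos.2 ⟨i, hi.1⟩
      omega
    · intro m hm hmB l hl hlA
      simp only [Finset.mem_insert, Finset.mem_erase] at hm hlA
      push Not at hlA
      rcases hm with rfl | ⟨-, hm⟩
      · exact absurd hk.1 hmB
      · refine h m hm hmB l hl fun hlA' => hlA.2 ?_ hlA'
        rintro rfl
        exact hi.2 hl
    · have : insert k (A.erase i) \ B = (A \ B).erase i := by
        ext m
        simp only [Finset.mem_sdiff, Finset.mem_insert, Finset.mem_erase]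
        constructor
        · rintro ⟨rfl | h, h'⟩
          · exact absurd hk.1 h'
          · exact ⟨h.1, h.2, h'⟩
        · rintro ⟨h, h', h''⟩
          exact ⟨Or.inr ⟨h, h'⟩, h''⟩
      rw [this, Finset.card_erase_of_mem (Finset.mem_sdiff.2 hi), hd]
      rfl

theorem superarmMean_fastest_le (hlam : ∀ i, 0 < lam i) {A : Finset (Fin n)} :
    superarmMean lam (fastest lam A.card) ≤ superarmMean lam A :=
  superarmMean_le_of_forall_mean_le hlam
    (card_fastest (by simpa using Finset.card_le_univ A)).symm
    fun _ _ hi _ hk _ => mean_le_of_mem_fastest hk hi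

theorem superarmMean_le_slowest (hlam : ∀ i, 0 < lam i) {A : Finset (Fin n)} :
    superarmMean lam A ≤ superarmMean lam (slowest lam A.card) :=
  superarmMean_le_of_forall_mean_le hlam
    (card_slowest (by simpa using Finset.card_le_univ A))
    fun _ hi _ _ _ hk => mean_le_of_mem_slowest hi hk

theorem bestMean_eq (hlam : ∀ i, 0 < lam i) {r : ℕ} (hr : r ≤ n) :
    bestMean lam r = superarmMean lam (fastest lam r) := by
  refine le_antisymm (csInf_le (Set.toFinite _).bddBelow ⟨_, card_fastest hr, rfl⟩)
    (le_csInf ⟨_, fastest lam r, card_fastest hr, rfl⟩ ?_)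
  rintro _ ⟨A, rfl, rfl⟩
  exact superarmMean_fastest_le hlam

theorem superarmGapMax_nonneg (hlam : ∀ i, 0 < lam i) {r : ℕ} (hr : r ≤ n) :
    0 ≤ superarmGapMax lam r := by
  have h := superarmMean_le_slowest hlam (A := fastest lam r)
  rw [card_fastest hr] at h
  exact sub_nonneg.2 h

/-- A superarm that employs, instead of one of the fastest workers, a strictly slower one. -/
def IsSuboptimal (lam : Fin n → ℝ) (A : Finset (Fin n)) : Prop :=
  ∃ i ∈ A, ∃ k ∈ fastest lam A.card, k ∉ A ∧ mean lam k < mean lam i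

-- If `A` is not suboptimal, no member of `A` is strictly slower than an omitted member of the
-- fastest superarm. This is the exchange condition in the reverse direction, so `A` is itself
-- optimal.
open Classical in
theorem superarmMean_sub_bestMean_le (hlam : ∀ i, 0 < lam i) (A : Finset (Fin n)) :
    superarmMean lam A - bestMean lam A.card ≤
      if IsSuboptimal lam A then superarmGapMax lam A.card else 0 := by
  have hr : A.card ≤ n := by simpa using Finset.card_le_univ A
  rw [bestMean_eq hlam hr]
  split_ifs with h
  · exact sub_le_sub_right (superarmMean_le_slowest hlam) _
  · rw [sub_nonpos]
    refine superarmMean_le_of_forall_mean_le hlam (card_fastest hr) fun k hk hkA i hi _ => ?_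
    by_contra hlt
    exact h ⟨i, hi, k, hk, hkA, not_le.1 hlt⟩

end ResponseTime

end CMAB

namespace CMAB

/-! ### Sub-gamma and sub-Gaussian bounds for centred exponentials. -/

section TiltBounds

/-- This is `t ≤ sinh t` at `t = log y`. -/
theorem log_le_half_sub_inv {y : ℝ} (hy : 1 ≤ y) : Real.log y ≤ (y - y⁻¹) / 2 := by
  have h := Real.self_le_sinh_iff.2 (Real.log_nonneg hy)
  rwa [Real.sinh_eq, Real.exp_neg, Real.exp_log (by linarith)] at h

/-- A centred exponential variable of mean at most one is sub-gamma on the right. -/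
theorem div_sub_mul_exp_le_one {l x : ℝ} (hl : 1 ≤ l) (hx : 0 ≤ x) :
    l / (l - x / (1 + x)) * Real.exp (-(x / (1 + x) * (1 / l)) - x ^ 2 / (2 * (1 + x))) ≤ 1 := by
  set θ := x / (1 + x) with hθ
  have hx1 : 0 < 1 + x := by linarith
  have hθ0 : 0 ≤ θ := by positivity
  have hθ1 : θ < 1 := by rw [hθ, div_lt_one hx1]; linarith
  have hl0 : 0 < l := by linarith
  have hlθ : 0 < l - θ := by linarith
  have hy : 1 ≤ l / (l - θ) := by rw [le_div_iff₀ hlθ]; linarith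
  have hlog := log_le_half_sub_inv hy
  rw [← Real.exp_log (show 0 < l / (l - θ) by positivity), ← Real.exp_add]
  rw [Real.exp_le_one_iff]
  -- The first term cancels the centring; the second is largest at `l = 1`, where it equals `x² / (2
  -- (1 + x))`.
  have h1 : (l / (l - θ) - (l / (l - θ))⁻¹) / 2 = θ * (1 / l) + θ ^ 2 / (2 * (l * (l - θ))) := by
    field_simp
    ring
  have h2 : x ^ 2 / (2 * (1 + x)) = θ ^ 2 / (2 * (1 * (1 - θ))) := by
    have : 1 - θ = 1 / (1 + x) := by rw [hθ]; field_simp; ring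
    rw [this, hθ]
    field_simp
  have h3 : θ ^ 2 / (2 * (l * (l - θ))) ≤ θ ^ 2 / (2 * (1 * (1 - θ))) := by
    have : 0 < 1 - θ := by linarith
    gcongr
  linarith

/-- A centred exponential variable of mean at most one is sub-Gaussian on the left. -/
theorem div_add_mul_exp_le_one {l x : ℝ} (hl : 1 ≤ l) (hx : 0 ≤ x) :
    l / (l - -x) * Real.exp (-(-x * (1 / l)) - x ^ 2 / 2) ≤ 1 := by
  have hl0 : 0 < l := by linarith
  set w := x / l with hw
  have hw0 : 0 ≤ w := by positivity
  have hwx : w ≤ x := div_le_self hx hl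
  have h1 : l / (l - -x) = (1 + w)⁻¹ := by
    have : l + x ≠ 0 := by positivity
    rw [hw, sub_neg_eq_add]
    field_simp
  have hlog := Real.le_log_one_add_of_nonneg hw0
  -- After clearing the denominator the two sides differ by `w³ / 2`.
  have h2 : w - w ^ 2 / 2 ≤ 2 * w / (w + 2) := by
    rw [le_div_iff₀ (by linarith)]
    nlinarith [pow_nonneg hw0 3]
  have h3 : w ^ 2 ≤ x ^ 2 := by gcongr
  rw [h1, ← Real.exp_log (show 0 < (1 + w)⁻¹ by positivity), ← Real.exp_add,
    Real.exp_le_one_iff, Real.log_inv]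
  have h4 : -(-x * (1 / l)) = w := by rw [hw]; ring
  linarith

theorem lintegral_exp_tilt {l θ ψ : ℝ} (hl : 0 < l) (hθ : θ < l) :
    ∫⁻ x, ENNReal.ofReal (Real.exp (θ * (x - 1 / l) - ψ)) ∂(expMeasure l) =
      ENNReal.ofReal (l / (l - θ) * Real.exp (-(θ * (1 / l)) - ψ)) := by
  have h : ∀ x, ENNReal.ofReal (Real.exp (θ * (x - 1 / l) - ψ)) =
      ENNReal.ofReal (Real.exp (θ * x)) * ENNReal.ofReal (Real.exp (-(θ * (1 / l)) - ψ)) := by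
    intro x
    rw [← ENNReal.ofReal_mul (Real.exp_pos _).le, ← Real.exp_add]
    congr 2
    ring
  have hpos : 0 < l - θ := sub_pos.2 hθ
  simp_rw [h]
  rw [lintegral_mul_const _ (by fun_prop), lintegral_exp_mul_expMeasure hl hθ,
    ← ENNReal.ofReal_mul (by positivity)]

end TiltBounds

/-! ### Concentration of empirical means under predictable sampling. -/

section Concentration

variable {Ω : Type*} {mΩ : MeasurableSpace Ω} {P : Measure Ω} {ℱ : Filtration ℕ mΩ} {n : ℕ}
  {lam : Fin n → ℝ} {X : ℕ → Fin n → Ω → ℝ} {A : ℕ → Ω → Finset (Fin n)} {N : ℕ}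

theorem measurableSet_superarm {m : MeasurableSpace Ω} {B : Ω → Finset (Fin n)}
    (hB : ∀ S, MeasurableSet[m] {ω | B ω = S}) (p : Finset (Fin n) → Prop) :
    MeasurableSet[m] {ω | p (B ω)} := by
  have : {ω | p (B ω)} = ⋃ S ∈ {S | p S}, {ω | B ω = S} := by
    ext ω; simp
  rw [this]
  exact MeasurableSet.biUnion (Set.to_countable _) fun S _ => hB S

theorem pullCount_succ (i : Fin n) (t : ℕ) (ω : Ω) :
    pullCount A i (t + 1) ω = pullCount A i t ω + if i ∈ A (t + 1) ω then 1 else 0 := by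
  unfold pullCount
  rw [← Finset.insert_Icc_right_eq_Icc_add_one (by omega), Finset.filter_insert]
  split_ifs with h
  · rw [Finset.card_insert_of_notMem (by simp)]
  · rfl

theorem respSum_succ (i : Fin n) (t : ℕ) (ω : Ω) :
    respSum X A i (t + 1) ω =
      respSum X A i t ω + if i ∈ A (t + 1) ω then X (t + 1) i ω else 0 :=
  Finset.sum_Icc_succ_top (by omega) _

theorem pullCount_le (i : Fin n) (t : ℕ) (ω : Ω) : pullCount A i t ω ≤ t :=
  (Finset.card_filter_le _ _).trans (by simp)

theorem measurable_pullCount (hA : ∀ y < N, ∀ S : Finset (Fin n), MeasurableSet[ℱ y]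
    {ω | A (y + 1) ω = S}) (i : Fin n) {t : ℕ} (ht : t ≤ N) :
    Measurable[ℱ t] (pullCount A i t) := by
  induction t with
  | zero => exact measurable_const
  | succ t ih =>
    have : pullCount A i (t + 1) =
        fun ω => pullCount A i t ω + if i ∈ A (t + 1) ω then 1 else 0 :=
      funext fun ω => pullCount_succ i t ω
    rw [this]
    have hm : Measurable[ℱ t]
        fun ω => pullCount A i t ω + if i ∈ A (t + 1) ω then 1 else 0 :=
      (ih (by omega)).add (Measurable.ite
        (measurableSet_superarm (hA t (by omega)) fun S => i ∈ S)
        measurable_const measurable_const)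
    exact hm.mono (ℱ.mono t.le_succ) le_rfl

theorem measurable_respSum (hX : ∀ y i, Measurable[ℱ (y + 1)] (X (y + 1) i))
    (hA : ∀ y < N, ∀ S : Finset (Fin n), MeasurableSet[ℱ y] {ω | A (y + 1) ω = S})
    (i : Fin n) {t : ℕ} (ht : t ≤ N) : Measurable[ℱ t] (respSum X A i t) := by
  induction t with
  | zero => exact measurable_const
  | succ t ih =>
    have : respSum X A i (t + 1) =
        fun ω => respSum X A i t ω + if i ∈ A (t + 1) ω then X (t + 1) i ω else 0 :=
      funext fun ω => respSum_succ i t ω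
    rw [this]
    exact ((ih (by omega)).mono (ℱ.mono t.le_succ) le_rfl).add (Measurable.ite
        (ℱ.mono t.le_succ _ (measurableSet_superarm (hA t (by omega)) fun S => i ∈ S))
        (hX t i) measurable_const)

/-- The exponential process of a worker that is sampled at predictable times is a
supermartingale. -/
theorem lintegral_exp_respSum_le_one [IsProbabilityMeasure P] (hX : IsResponseModel P ℱ lam X)
    (hA : ∀ y < N, ∀ S : Finset (Fin n), MeasurableSet[ℱ y] {ω | A (y + 1) ω = S})
    (i : Fin n) {θ ψ c : ℝ}
    (h : ∫⁻ x, ENNReal.ofReal (Real.exp (θ * (x - c) - ψ)) ∂(expMeasure (lam i)) ≤ 1)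
    {t : ℕ} (ht : t ≤ N) :
    ∫⁻ ω, ENNReal.ofReal (Real.exp (θ * (respSum X A i t ω - pullCount A i t ω * c)
      - pullCount A i t ω * ψ)) ∂P ≤ 1 := by
  induction t with
  | zero => simp [respSum, pullCount]
  | succ t ih =>
    set M : Ω → ENNReal := fun ω => ENNReal.ofReal (Real.exp
      (θ * (respSum X A i t ω - pullCount A i t ω * c) - pullCount A i t ω * ψ)) with hM
    set E : Set Ω := {ω | i ∈ A (t + 1) ω} with hE
    set g : Ω → ENNReal := fun ω =>
      ENNReal.ofReal (Real.exp (θ * (X (t + 1) i ω - c) - ψ)) with hg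
    have hEm : MeasurableSet[ℱ t] E :=
      measurableSet_superarm (hA t (by omega)) fun S => i ∈ S
    have hMm : Measurable[ℱ t] M := by
      have h1 := measurable_respSum hX.adapted hA i (t := t) (by omega)
      have h2 : Measurable[ℱ t] fun ω => (pullCount A i t ω : ℝ) :=
        Measurable.comp measurable_from_top (measurable_pullCount hA i (t := t) (by omega))
      exact ((((h1.sub (h2.mul_const c)).const_mul θ).sub (h2.mul_const ψ)).exp).ennreal_ofReal
    have hXm : Measurable (X (t + 1) i) := (hX.adapted t i).mono (ℱ.le _) le_rfl
    have hgle : ∫⁻ ω, g ω ∂P ≤ 1 := by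
      rw [← hX.law t i, lintegral_map (by fun_prop) hXm] at h
      exact h
    -- If worker `i` is not employed the process stands still; otherwise it is multiplied by a fresh
    -- factor `g`, independent of `ℱ t` and of mean at most one.
    have hsplit : ∀ ω, ENNReal.ofReal (Real.exp
        (θ * (respSum X A i (t + 1) ω - pullCount A i (t + 1) ω * c)
          - pullCount A i (t + 1) ω * ψ)) =
        Eᶜ.indicator M ω + E.indicator M ω * g ω := by
      intro ω
      rw [respSum_succ, pullCount_succ]
      by_cases hω : i ∈ A (t + 1) ω
      · have hωE : ω ∈ E := hω
        simp only [hω, if_true, Set.indicator_of_mem hωE,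
          Set.indicator_of_notMem (Set.notMem_compl_iff.2 hωE), zero_add, hM, hg]
        rw [← ENNReal.ofReal_mul (Real.exp_pos _).le, ← Real.exp_add]
        push_cast
        congr 2
        ring
      · have hωE : ω ∉ E := hω
        simp only [hω, if_false, Set.indicator_of_notMem hωE,
          Set.indicator_of_mem (Set.mem_compl hωE), hM, zero_mul, add_zero]
    have hind : Indep (ℱ t) (MeasurableSpace.comap (X (t + 1) i) inferInstance) P := by
      refine indep_of_indep_of_le_right (hX.indep_past t) ?_
      have : X (t + 1) i = (fun v : Fin n → ℝ => v i) ∘ fun ω i => X (t + 1) i ω := rfl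
      rw [this, ← MeasurableSpace.comap_comp]
      exact MeasurableSpace.comap_mono (measurable_pi_apply i).comap_le
    have hgm : Measurable[MeasurableSpace.comap (X (t + 1) i) inferInstance] g :=
      Measurable.comp (g := fun x : ℝ => ENNReal.ofReal (Real.exp (θ * (x - c) - ψ)))
        (by fun_prop) (comap_measurable _)
    simp_rw [hsplit]
    rw [lintegral_add_left ((hMm.indicator hEm.compl).mono (ℱ.le _) le_rfl),
      lintegral_mul_eq_lintegral_mul_lintegral_of_independent_measurableSpace (ℱ.le t)
        hXm.comap_le hind (hMm.indicator hEm) hgm]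
    calc ∫⁻ ω, Eᶜ.indicator M ω ∂P + (∫⁻ ω, E.indicator M ω ∂P) * ∫⁻ ω, g ω ∂P
        ≤ ∫⁻ ω, Eᶜ.indicator M ω ∂P + (∫⁻ ω, E.indicator M ω ∂P) * 1 := by gcongr
      _ = ∫⁻ ω, M ω ∂P := by
          rw [mul_one, ← lintegral_add_left
            ((hMm.indicator hEm.compl).mono (ℱ.le _) le_rfl)]
          refine lintegral_congr fun ω => ?_
          exact congrFun (Set.indicator_compl_add_self E M) ω
      _ ≤ 1 := ih (by omega)

/-- Markov's inequality for the exponential process. -/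
theorem measure_le_exp_neg_of_tilt [IsProbabilityMeasure P] (hX : IsResponseModel P ℱ lam X)
    (hA : ∀ y < N, ∀ S : Finset (Fin n), MeasurableSet[ℱ y] {ω | A (y + 1) ω = S})
    (i : Fin n) {θ ψ c τ : ℝ}
    (h : ∫⁻ x, ENNReal.ofReal (Real.exp (θ * (x - c) - ψ)) ∂(expMeasure (lam i)) ≤ 1)
    {t : ℕ} (ht : t ≤ N) {B : Set Ω}
    (hB : ∀ ω ∈ B, τ ≤ θ * (respSum X A i t ω - pullCount A i t ω * c)
      - pullCount A i t ω * ψ) :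
    P B ≤ ENNReal.ofReal (Real.exp (-τ)) := by
  have h1 := lintegral_exp_respSum_le_one hX hA i h ht
  have h2 : ENNReal.ofReal (Real.exp τ) * P B ≤ 1 := by
    refine le_trans ?_ h1
    have hm : Measurable fun ω => ENNReal.ofReal (Real.exp
        (θ * (respSum X A i t ω - pullCount A i t ω * c) - pullCount A i t ω * ψ)) := by
      have h1 : Measurable (respSum X A i t) :=
        (measurable_respSum hX.adapted hA i ht).mono (ℱ.le _) le_rfl
      have h2 : Measurable fun ω => (pullCount A i t ω : ℝ) :=
        measurable_from_top.comp ((measurable_pullCount hA i ht).mono (ℱ.le _) le_rfl)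
      fun_prop
    refine le_trans ?_ (mul_meas_ge_le_lintegral hm (ENNReal.ofReal (Real.exp τ)))
    gcongr
    exact fun ω hω => ENNReal.ofReal_le_ofReal (Real.exp_le_exp.2 (hB ω hω))
  rw [Real.exp_neg, ENNReal.ofReal_inv_of_pos (Real.exp_pos _), ← one_div]
  rw [ENNReal.le_div_iff_mul_le (Or.inl (by simp [Real.exp_pos])) (Or.inl ENNReal.ofReal_ne_top),
    mul_comm]
  exact h2

/-- The empirical mean of worker `i` after iteration `t` deviates from the mean by more than the
radius `confRadius` upwards, or by more than its sub-Gaussian part downwards. -/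
def deviation (lam : Fin n → ℝ) (X : ℕ → Fin n → Ω → ℝ) (A : ℕ → Ω → Finset (Fin n))
    (i : Fin n) (t : ℕ) : Set Ω :=
  {ω | pullCount A i t ω ≠ 0 ∧
    (mean lam i + confRadius t (pullCount A i t ω) < empMean X A i t ω ∨
      empMean X A i t ω < mean lam i - √(4 * explore t / pullCount A i t ω))}

theorem explore_nonneg (t : ℕ) : 0 ≤ explore t := by
  unfold explore
  have := Real.log_natCast_nonneg t
  positivity

/-- For each counter value `s ≤ t`, either tail has probability at most `exp (-2 f(t)) = t⁻⁴`. The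
union over `s` gives `2 t⁻³`. Only the upper tail of an exponential is heavier than Gaussian, so
only upward deviations need the linear term of the radius. -/
theorem measure_deviation_le [IsProbabilityMeasure P] (hX : IsResponseModel P ℱ lam X)
    (hA : ∀ y < N, ∀ S : Finset (Fin n), MeasurableSet[ℱ y] {ω | A (y + 1) ω = S})
    (hlam : ∀ i, 1 ≤ lam i) (i : Fin n) {t : ℕ} (ht : t ≤ N) :
    P (deviation lam X A i t) ≤ ENNReal.ofReal (2 * (1 / (t : ℝ) ^ 2)) := by
  -- At `t = 0` the right-hand side is `0` by the convention for division by zero, and the event is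
  -- empty because nothing has been sampled.
  rcases Nat.eq_zero_or_pos t with rfl | htpos
  · simp [deviation, pullCount]
  have hl : 0 < lam i := by linarith [hlam i]
  set x : ℕ → ℝ := fun s => √(4 * explore t / s) with hx
  have hx0 : ∀ s, 0 ≤ x s := fun s => Real.sqrt_nonneg _
  have hxsq : ∀ s, x s ^ 2 = 4 * explore t / s := fun s =>
    Real.sq_sqrt (div_nonneg (mul_nonneg (by norm_num) (explore_nonneg t)) (Nat.cast_nonneg _))
  set U : ℕ → Set Ω := fun s => {ω | pullCount A i t ω = s ∧
    mean lam i + confRadius t s < empMean X A i t ω} with hU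
  set L : ℕ → Set Ω := fun s => {ω | pullCount A i t ω = s ∧
    empMean X A i t ω < mean lam i - x s} with hL
  have hsub : deviation lam X A i t ⊆ ⋃ s ∈ Finset.Icc 1 t, (U s ∪ L s) := by
    rintro ω ⟨h0, h⟩
    simp only [Set.mem_iUnion]
    refine ⟨pullCount A i t ω, ?_, ?_⟩
    · simp only [Finset.mem_Icc]
      exact ⟨Nat.one_le_iff_ne_zero.2 h0, pullCount_le i t ω⟩
    · rcases h with h | h
      · exact Or.inl ⟨rfl, h⟩
      · exact Or.inr ⟨rfl, h⟩
  set p := ENNReal.ofReal (Real.exp (-(2 * explore t))) with hp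
  have hsum : ∀ ω {s : ℕ}, 1 ≤ s → pullCount A i t ω = s →
      respSum X A i t ω = s * empMean X A i t ω := by
    intro ω s hs h
    have : (s : ℝ) ≠ 0 := by positivity
    rw [empMean, h]
    field_simp
  have hUle : ∀ s ∈ Finset.Icc 1 t, P (U s) ≤ p := by
    intro s hs
    have hs1 := (Finset.mem_Icc.1 hs).1
    have hspos : (0 : ℝ) < s := by exact_mod_cast hs1
    have hx1 : 0 < 1 + x s := by linarith [hx0 s]
    have hθ : x s / (1 + x s) < lam i :=
      lt_of_lt_of_le (by rw [div_lt_one hx1]; linarith) (hlam i)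
    refine measure_le_exp_neg_of_tilt hX hA i (θ := x s / (1 + x s)) (c := 1 / lam i)
      (ψ := x s ^ 2 / (2 * (1 + x s))) ?_ ht ?_
    · rw [lintegral_exp_tilt hl hθ]
      exact ENNReal.ofReal_le_one.2 (div_sub_mul_exp_le_one (hlam i) (hx0 s))
    · rintro ω ⟨h1, h2⟩
      rw [hsum ω hs1 h1, h1]
      have hrad : confRadius t s = x s + x s ^ 2 / 2 := by
        rw [hxsq, confRadius]; ring
      rw [hrad, mean] at h2
      -- The tilt `x / (1 + x)` is matched to the radius `x + x² / 2`: the exponent is exactly `s x²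
      -- / 2`, which is `2 f(t)` since `x² = 4 f(t) / s`.
      have h3 : x s / (1 + x s) * (s * (x s + x s ^ 2 / 2)) - s * (x s ^ 2 / (2 * (1 + x s)))
          = 2 * explore t := by
        have : 2 * explore t = s * x s ^ 2 / 2 := by rw [hxsq]; field_simp; ring
        rw [this]
        field_simp
        ring
      rw [← h3]
      have : x s + x s ^ 2 / 2 ≤ empMean X A i t ω - 1 / lam i := by linarith
      have hθ0 : 0 ≤ x s / (1 + x s) := div_nonneg (hx0 s) hx1.le
      rw [← mul_sub]
      gcongr
  have hLle : ∀ s ∈ Finset.Icc 1 t, P (L s) ≤ p := by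
    intro s hs
    have hs1 := (Finset.mem_Icc.1 hs).1
    have hspos : (0 : ℝ) < s := by exact_mod_cast hs1
    refine measure_le_exp_neg_of_tilt hX hA i (θ := -x s) (c := 1 / lam i)
      (ψ := x s ^ 2 / 2) ?_ ht ?_
    · rw [lintegral_exp_tilt hl (by linarith [hx0 s])]
      exact ENNReal.ofReal_le_one.2 (div_add_mul_exp_le_one (hlam i) (hx0 s))
    · rintro ω ⟨h1, h2⟩
      rw [hsum ω hs1 h1, h1]
      rw [mean] at h2
      have h3 : x s * (s * x s) - s * (x s ^ 2 / 2) = 2 * explore t := by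
        have : 2 * explore t = s * x s ^ 2 / 2 := by rw [hxsq]; field_simp; ring
        rw [this]
        ring
      rw [← h3, ← mul_sub, neg_mul, ← mul_neg, ← mul_neg]
      have : x s ≤ -(empMean X A i t ω - 1 / lam i) := by linarith
      have := hx0 s
      gcongr
  have hpe : p = ENNReal.ofReal (1 / (t : ℝ) ^ 4) := by
    rw [hp]
    congr 1
    have : -(2 * explore t) = -(4 * Real.log t) := by unfold explore; ring
    rw [this, Real.exp_neg, one_div]
    congr 1
    have h4 : (4 : ℝ) * Real.log t = Real.log ((t : ℝ) ^ 4) := by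
      rw [Real.log_pow]; norm_num
    rw [h4, Real.exp_log (by positivity)]
  calc P (deviation lam X A i t) ≤ P (⋃ s ∈ Finset.Icc 1 t, (U s ∪ L s)) := measure_mono hsub
    _ ≤ ∑ s ∈ Finset.Icc 1 t, P (U s ∪ L s) := measure_biUnion_finset_le _ _
    _ ≤ ∑ s ∈ Finset.Icc 1 t, (p + p) := Finset.sum_le_sum fun s hs =>
        (measure_union_le _ _).trans (add_le_add (hUle s hs) (hLle s hs))
    _ = ENNReal.ofReal (t * (1 / (t : ℝ) ^ 4 + 1 / (t : ℝ) ^ 4)) := by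
        rw [Finset.sum_const, Nat.card_Icc, Nat.add_sub_cancel, nsmul_eq_mul, hpe,
          ← ENNReal.ofReal_add (by positivity) (by positivity),
          ENNReal.ofReal_mul (by positivity), ENNReal.ofReal_natCast]
    _ ≤ ENNReal.ofReal (2 * (1 / (t : ℝ) ^ 2)) := by
        refine ENNReal.ofReal_le_ofReal ?_
        have ht1 : (1 : ℝ) ≤ t := by exact_mod_cast htpos
        have : (t : ℝ) * (1 / (t : ℝ) ^ 4 + 1 / (t : ℝ) ^ 4) = 2 * (1 / (t : ℝ) ^ 3) := by
          field_simp; ring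
        rw [this]
        gcongr
        norm_num

theorem measurableSet_deviation (hX : IsResponseModel P ℱ lam X)
    (hA : ∀ y < N, ∀ S : Finset (Fin n), MeasurableSet[ℱ y] {ω | A (y + 1) ω = S})
    (i : Fin n) {t : ℕ} (ht : t ≤ N) : MeasurableSet (deviation lam X A i t) := by
  have h1 : Measurable (respSum X A i t) :=
    (measurable_respSum hX.adapted hA i ht).mono (ℱ.le _) le_rfl
  have h2 : Measurable (pullCount A i t) :=
    (measurable_pullCount hA i ht).mono (ℱ.le _) le_rfl
  have h3 : ∀ f : ℕ → ℝ, Measurable fun ω => f (pullCount A i t ω) := fun f =>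
    measurable_from_top.comp h2
  have h4 : Measurable (empMean X A i t) := h1.div (h3 fun s => s)
  refine MeasurableSet.inter (h2 (MeasurableSet.of_discrete (s := {s | s ≠ 0})))
    (MeasurableSet.union ?_ ?_)
  · exact measurableSet_lt (measurable_const.add (h3 fun s => confRadius t s)) h4
  · exact measurableSet_lt h4 (measurable_const.sub (h3 fun s => √(4 * explore t / s)))

/-- Without deviations, a sufficiently explored worker that is `δ` slower than another one has the
larger lower confidence bound. -/
theorem not_lcb_le_lcb {i k : Fin n} {t j : ℕ} {ω : Ω} {δ : ℝ} (hδ : 0 < δ)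
    (hδik : δ ≤ mean lam i - mean lam k) (hδ1 : δ ≤ 1)
    (hi : ω ∉ deviation lam X A i t) (hk : ω ∉ deviation lam X A k t)
    (hcount : pullCount A i t ω ≠ 0)
    (hlarge : 48 * Real.log j / min (δ ^ 2) δ ≤ pullCount A i t ω) (htj : t ≤ j) :
    ¬ lcb confRadius X A i t ω ≤ lcb confRadius X A k t ω := by
  intro hle
  have hlog : Real.log t ≤ Real.log j := by
    rcases Nat.eq_zero_or_pos t with rfl | h
    · simpa using Real.log_natCast_nonneg j
    · exact Real.log_le_log (by exact_mod_cast h) (by exact_mod_cast htj)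
  have hlog0 := Real.log_natCast_nonneg t
  -- An unemployed `k` would have bound `⊥`, below the finite bound of `i`.
  have hk0 : pullCount A k t ω ≠ 0 := by
    intro h0
    rw [lcb, lcb, if_neg hcount, if_pos h0, le_bot_iff] at hle
    exact EReal.coe_ne_bot _ hle
  simp only [lcb, hcount, hk0, if_false, EReal.coe_le_coe_iff] at hle
  simp only [deviation, Set.mem_ofPred_eq, not_and, not_or, not_lt] at hi hk
  have h1 := (hi hcount).2
  have h2 := (hk hk0).1
  set s : ℝ := (pullCount A i t ω : ℝ) with hs
  have hspos : 0 < s := by rw [hs]; exact_mod_cast Nat.pos_of_ne_zero hcount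
  have hmin : min (δ ^ 2) δ = δ ^ 2 := min_eq_left (by nlinarith)
  rw [hmin, div_le_iff₀ (by positivity)] at hlarge
  have hratio : explore t / s ≤ δ ^ 2 / 24 := by
    rw [div_le_iff₀ hspos, explore]
    linarith
  -- Here `1/6 ≤ (5/12)²`. The bound of `i` lies below its mean by at most two square roots and one
  -- linear term, hence by at most `(5/12 + 5/12 + 1/12) δ = 11/12 δ < δ`, while the bound of `k` is
  -- at most the mean of `k`.
  have hsqrt : √(4 * explore t / s) ≤ 5 / 12 * δ := by
    rw [Real.sqrt_le_left (by positivity)]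
    rw [mul_div_assoc]
    nlinarith [sq_nonneg δ]
  have hsecond : 2 * explore t / s ≤ δ / 12 := by
    rw [mul_div_assoc]
    nlinarith
  rw [confRadius] at hle
  linarith

end Concentration

end CMAB

namespace CMAB

/-! ### Expected cost of one iteration. -/

section Expectation

variable {Ω : Type*} {mΩ : MeasurableSpace Ω} {P : Measure Ω} {ℱ : Filtration ℕ mΩ} {n : ℕ}
  {lam : Fin n → ℝ} {X : ℕ → Fin n → Ω → ℝ}

theorem apply_eq_sum_indicator {E : Type*} [AddCommMonoid E] (B : Ω → Finset (Fin n))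
    (h : Finset (Fin n) → Ω → E) (ω : Ω) :
    h (B ω) ω = ∑ S, {ω | B ω = S}.indicator (h S) ω := by
  rw [Finset.sum_eq_single (B ω)]
  · simp
  · intro S _ hS
    exact Set.indicator_of_notMem (s := {ω | B ω = S}) (fun h' => hS (Eq.symm h')) (h S)
  · simp

theorem integrable_superarm [IsFiniteMeasure P] {B : Ω → Finset (Fin n)}
    (hB : ∀ S, MeasurableSet {ω | B ω = S}) (h : Finset (Fin n) → ℝ) :
    Integrable (fun ω => h (B ω)) P := by
  simp_rw [apply_eq_sum_indicator B fun S _ => h S]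
  exact integrable_finsetSum _ fun S _ => (integrable_const _).indicator (hB S)

theorem integral_superarm [IsFiniteMeasure P] {B : Ω → Finset (Fin n)}
    (hB : ∀ S, MeasurableSet {ω | B ω = S}) (h : Finset (Fin n) → ℝ) :
    ∫ ω, h (B ω) ∂P = ∑ S, P.real {ω | B ω = S} * h S := by
  simp_rw [apply_eq_sum_indicator B fun S _ => h S]
  rw [integral_finsetSum _ fun S _ => (integrable_const _).indicator (hB S)]
  refine Finset.sum_congr rfl fun S _ => ?_
  rw [integral_indicator_const _ (hB S), smul_eq_mul]

theorem IsResponseModel.measurable (hX : IsResponseModel P ℱ lam X) (y : ℕ) (i : Fin n) :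
    Measurable (X (y + 1) i) :=
  (hX.adapted y i).mono (ℱ.le _) le_rfl

theorem IsResponseModel.integrable (hX : IsResponseModel P ℱ lam X) (hlam : ∀ i, 0 < lam i)
    (y : ℕ) (i : Fin n) : Integrable (X (y + 1) i) P := by
  have h := integrable_id_expMeasure (hlam i)
  rw [← hX.law y i] at h
  exact (integrable_map_measure h.aestronglyMeasurable (hX.measurable y i).aemeasurable).1 h

theorem IsResponseModel.map_eq_pi [IsProbabilityMeasure P] (hX : IsResponseModel P ℱ lam X)
    (y : ℕ) :
    P.map (fun ω i => X (y + 1) i ω) = Measure.pi fun i => expMeasure (lam i) := by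
  have hinj : Function.Injective fun i : Fin n => (y, i) := fun _ _ h => (Prod.ext_iff.1 h).2
  have h := (hX.indep.precomp hinj).map_fun_eq_pi_map fun i => (hX.measurable y i).aemeasurable
  simpa only [Function.comp_def, hX.law] using h

theorem IsResponseModel.integral_responseTime [IsProbabilityMeasure P]
    (hX : IsResponseModel P ℱ lam X) (y : ℕ) (S : Finset (Fin n)) :
    ∫ ω, responseTime (fun i => X (y + 1) i ω) S ∂P = superarmMean lam S := by
  rw [superarmMean, ← hX.map_eq_pi y,
    integral_map (measurable_pi_lambda _ (hX.measurable y)).aemeasurable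
      (measurable_responseTime S).aestronglyMeasurable]

theorem IsResponseModel.integrable_responseTime_superarm [IsProbabilityMeasure P]
    (hX : IsResponseModel P ℱ lam X) (hlam : ∀ i, 0 < lam i) (y : ℕ)
    {B : Ω → Finset (Fin n)} (hB : ∀ S, MeasurableSet {ω | B ω = S}) :
    Integrable (fun ω => responseTime (fun i => X (y + 1) i ω) (B ω)) P := by
  simp_rw [apply_eq_sum_indicator B fun S ω => responseTime (fun i => X (y + 1) i ω) S]
  exact integrable_finsetSum _ fun S _ =>
    (integrable_responseTime (hX.measurable y) (hX.integrable hlam y) S).indicator (hB S)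

/-- A superarm chosen from the past responds on average after its expected response time. -/
theorem IsResponseModel.integral_responseTime_superarm [IsProbabilityMeasure P]
    (hX : IsResponseModel P ℱ lam X) (hlam : ∀ i, 0 < lam i) (y : ℕ)
    {B : Ω → Finset (Fin n)} (hB : ∀ S, MeasurableSet[ℱ y] {ω | B ω = S}) :
    ∫ ω, responseTime (fun i => X (y + 1) i ω) (B ω) ∂P = ∫ ω, superarmMean lam (B ω) ∂P := by
  have hB' : ∀ S, MeasurableSet {ω | B ω = S} := fun S => ℱ.le y _ (hB S)
  have hint := fun S => integrable_responseTime (hX.measurable y) (hX.integrable hlam y) S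
  rw [integral_superarm hB']
  simp_rw [apply_eq_sum_indicator B fun S ω => responseTime (fun i => X (y + 1) i ω) S]
  rw [integral_finsetSum _ fun S _ => (hint S).indicator (hB' S)]
  refine Finset.sum_congr rfl fun S _ => ?_
  set f : Ω → ℝ := {ω | B ω = S}.indicator 1 with hf
  set g : Ω → ℝ := fun ω => responseTime (fun i => X (y + 1) i ω) S with hg
  have hfm : Measurable[ℱ y] f := (measurable_const (a := (1 : ℝ))).indicator (hB S)
  have hgm : Measurable[MeasurableSpace.comap (fun ω i => X (y + 1) i ω) MeasurableSpace.pi] g :=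
    (measurable_responseTime S).comp (comap_measurable _)
  -- The choice of `S` is known after iteration `y`, and the response time of the fixed superarm `S`
  -- depends only on iteration `y + 1`; hence the integral factors.
  have hind : IndepFun f g P :=
    indep_of_indep_of_le_left (indep_of_indep_of_le_right (hX.indep_past y) hgm.comap_le)
      hfm.comap_le
  have hmul : ∀ ω, {ω | B ω = S}.indicator g ω = f ω * g ω := by
    intro ω
    by_cases h : ω ∈ {ω | B ω = S} <;> simp [hf, h]
  simp_rw [hmul]
  rw [hind.integral_fun_mul_eq_mul_integral (hfm.mono (ℱ.le y) le_rfl).aestronglyMeasurable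
    (hint S).aestronglyMeasurable, hf, integral_indicator_one (hB' S), hg,
    hX.integral_responseTime]

theorem IsResponseModel.integral_responseTime_sub_bestMean_le [IsProbabilityMeasure P]
    (hX : IsResponseModel P ℱ lam X) (hlam : ∀ i, 0 < lam i) (y : ℕ) {r : ℕ}
    {B : Ω → Finset (Fin n)} (hB : ∀ S, MeasurableSet[ℱ y] {ω | B ω = S})
    (hcard : ∀ ω, (B ω).card = r) :
    ∫ ω, responseTime (fun i => X (y + 1) i ω) (B ω) ∂P - bestMean lam r ≤
      superarmGapMax lam r * P.real {ω | IsSuboptimal lam (B ω)} := by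
  classical
  have hB' : ∀ S, MeasurableSet {ω | B ω = S} := fun S => ℱ.le y _ (hB S)
  have hsub : MeasurableSet {ω | IsSuboptimal lam (B ω)} := measurableSet_superarm hB' _
  calc _ = ∫ ω, (superarmMean lam (B ω) - bestMean lam r) ∂P := by
        rw [integral_sub (integrable_superarm hB' _) (integrable_const _),
          hX.integral_responseTime_superarm hlam y hB]
        simp
    _ ≤ ∫ ω, (if IsSuboptimal lam (B ω) then superarmGapMax lam r else 0) ∂P := by
        refine integral_mono (integrable_superarm hB' fun S => superarmMean lam S - bestMean lam r)
          (integrable_superarm hB' fun S =>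
            if IsSuboptimal lam S then superarmGapMax lam r else 0) fun ω => ?_
        have h := superarmMean_sub_bestMean_le hlam (B ω)
        rw [hcard ω] at h
        exact h
    _ = ∫ ω, {ω | IsSuboptimal lam (B ω)}.indicator (fun _ => superarmGapMax lam r) ω ∂P := by
        refine integral_congr_ae (ae_of_all _ fun ω => ?_)
        simp [Set.indicator]
    _ = superarmGapMax lam r * P.real {ω | IsSuboptimal lam (B ω)} := by
        rw [integral_indicator_const _ hsub, smul_eq_mul, mul_comm]

end Expectation

/-! ### Splitting the iterations into rounds. -/

section Rounds

variable {b : ℕ} {T : ℕ → ℕ}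

theorem exists_round (hT0 : T 0 = 0) {y : ℕ} (hy : 1 ≤ y) (hyT : y ≤ T b) :
    ∃ r ∈ Finset.Icc 1 b, T (r - 1) < y ∧ y ≤ T r := by
  classical
  have hex : ∃ r, y ≤ T r := ⟨b, hyT⟩
  have hpos : 1 ≤ Nat.find hex := by
    rw [Nat.one_le_iff_ne_zero]
    intro h0
    have := Nat.find_spec hex
    rw [h0, hT0] at this
    omega
  refine ⟨Nat.find hex, Finset.mem_Icc.2 ⟨hpos, Nat.find_min' hex hyT⟩, ?_, Nat.find_spec hex⟩
  exact not_le.1 (Nat.find_min hex (by omega))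

/-- The truncated rounds tile `1, …, j`. Rounds without iterations may be active, but their
intervals are empty. -/
theorem sum_Icc_eq_sum_activeRounds (hT0 : T 0 = 0) (hT : MonotoneOn T (Set.Icc 0 b)) {j : ℕ}
    (hjT : j ≤ T b) (g : ℕ → ℝ) :
    ∑ y ∈ Finset.Icc 1 j, g y =
      ∑ r ∈ activeRounds b T j, ∑ y ∈ Finset.Ioc (T (r - 1)) (min j (T r)), g y := by
  rw [← Finset.sum_biUnion]
  · refine Finset.sum_congr ?_ fun _ _ => rfl
    ext y
    simp only [Finset.mem_biUnion, Finset.mem_Ioc, le_min_iff, activeRounds, Finset.mem_filter]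
    constructor
    · intro hy
      obtain ⟨hy1, hyj⟩ := Finset.mem_Icc.1 hy
      obtain ⟨r, hr, h1, h2⟩ := exists_round hT0 hy1 (hyj.trans hjT)
      exact ⟨r, ⟨hr, h1.trans_le hyj⟩, h1, hyj, h2⟩
    · rintro ⟨r, -, h1, h2, -⟩
      exact Finset.mem_Icc.2 ⟨by omega, h2⟩
  · have key : ∀ r ∈ activeRounds b T j, ∀ s ∈ activeRounds b T j, r < s →
        Disjoint (Finset.Ioc (T (r - 1)) (min j (T r))) (Finset.Ioc (T (s - 1)) (min j (T s))) := by
      intro r hr s hs hrs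
      simp only [activeRounds, Finset.mem_filter, Finset.mem_Icc] at hr hs
      have : T r ≤ T (s - 1) := hT ⟨by omega, by omega⟩ ⟨by omega, by omega⟩ (by omega)
      rw [Finset.disjoint_left]
      intro y hy hy'
      simp only [Finset.mem_Ioc, le_min_iff] at hy hy'
      omega
    intro r hr s hs hrs
    rcases lt_or_gt_of_ne hrs with h | h
    · exact key r hr s hs h
    · exact (key s hs r hr h).symm

end Rounds

/-! ### Expected number of suboptimal iterations. -/

section Counting

variable {Ω : Type*} {mΩ : MeasurableSpace Ω} {P : Measure Ω} {ℱ : Filtration ℕ mΩ} {n b : ℕ}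
  {T : ℕ → ℕ} {lam : Fin n → ℝ} {X : ℕ → Fin n → Ω → ℝ} {A : ℕ → Ω → Finset (Fin n)}

/-- Each iteration counted here raises the counter of `i` by one, so the count stops at `m`. -/
theorem sum_employed_pullCount_lt (A : ℕ → Ω → Finset (Fin n)) (i : Fin n) (m j : ℕ) (ω : Ω) :
    (∑ t ∈ Finset.range j, if i ∈ A (t + 1) ω ∧ pullCount A i t ω < m then 1 else 0) =
      min (pullCount A i j ω) m := by
  induction j with
  | zero => simp [pullCount]
  | succ j ih =>
    rw [Finset.sum_range_succ, ih, pullCount_succ]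
    by_cases h : i ∈ A (j + 1) ω <;> simp only [h, true_and, false_and, if_true, if_false]
    · split_ifs <;> omega
    · rfl

theorem mean_le_one (hlam : ∀ i, 1 ≤ lam i) (i : Fin n) : mean lam i ≤ 1 := by
  rw [mean, div_le_one (by linarith [hlam i])]
  exact hlam i

theorem mean_pos (hlam : ∀ i, 1 ≤ lam i) (i : Fin n) : 0 < mean lam i :=
  one_div_pos.2 (by linarith [hlam i])

/-- A suboptimal choice is due to a worker that is not yet explored, or to a deviation. -/
theorem exists_pullCount_lt_or_mem_deviation (hlam : ∀ i, 1 ≤ lam i) (hT0 : T 0 = 0)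
    (hA : IsLCBPolicy ℱ b T confRadius X A) {t j m : ℕ} (htj : t < j) (hjT : j ≤ T b)
    (hm : 1 ≤ m) (hm' : 48 * Real.log j / min (gapMin lam b ^ 2) (gapMin lam b) ≤ m) {ω : Ω}
    (h : IsSuboptimal lam (A (t + 1) ω)) :
    (∃ i, i ∈ A (t + 1) ω ∧ pullCount A i t ω < m) ∨ ∃ i, ω ∈ deviation lam X A i t := by
  by_contra hcon
  push Not at hcon
  obtain ⟨hcount, hdev⟩ := hcon
  obtain ⟨i, hi, k, hk, hkA, hlt⟩ := h
  obtain ⟨r, hr, h1, h2⟩ := exists_round (b := b) hT0 (y := t + 1) (by omega) (by omega)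
  rw [hA.card_eq r hr (t + 1) h1 h2 ω] at hk
  have hkb := fastest_mono (Finset.mem_Icc.1 hr).2 hk
  have hδ := gapMin_le hkb hlt
  have hi' := hcount i hi
  refine not_lcb_le_lcb (gapMin_pos hkb hlt) hδ ?_ (hdev i) (hdev k) (by omega) ?_ htj.le
    (hA.lowest t (by omega) ω i hi k hkA)
  -- All means lie in `(0, 1]`, so the gap is at most one.
  · linarith [mean_le_one hlam i, mean_pos hlam k]
  · exact hm'.trans (by exact_mod_cast hi')

/-- The dichotomy bounds the number of suboptimal iterations pointwise by `n * m` plus the number of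
deviations; integration and the value of `ζ(2)` finish. -/
theorem sum_measure_isSuboptimal_le [IsProbabilityMeasure P] (hX : IsResponseModel P ℱ lam X)
    (hlam : ∀ i, 1 ≤ lam i) (hT0 : T 0 = 0) (hA : IsLCBPolicy ℱ b T confRadius X A) {j m : ℕ}
    (hjT : j ≤ T b) (hm : 1 ≤ m)
    (hm' : 48 * Real.log j / min (gapMin lam b ^ 2) (gapMin lam b) ≤ m) :
    ∑ t ∈ Finset.range j, P.real {ω | IsSuboptimal lam (A (t + 1) ω)} ≤
      n * (m + Real.pi ^ 2 / 3) := by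
  classical
  set D := fun (t : ℕ) (i : Fin n) => deviation lam X A i t with hD
  have hDm : ∀ t ∈ Finset.range j, ∀ i, MeasurableSet (D t i) := fun t ht i =>
    measurableSet_deviation hX hA.predictable i ((Finset.mem_range.1 ht).le.trans hjT)
  have hSm : ∀ t ∈ Finset.range j, MeasurableSet {ω | IsSuboptimal lam (A (t + 1) ω)} :=
    fun t ht => ℱ.le t _ (measurableSet_superarm
      (hA.predictable t ((Finset.mem_range.1 ht).trans_le hjT)) _)
  have hpoint : ∀ ω, ∑ t ∈ Finset.range j,
      {ω | IsSuboptimal lam (A (t + 1) ω)}.indicator (fun _ => (1 : ENNReal)) ω ≤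
        ((n * m : ℕ) : ENNReal) +
          ∑ t ∈ Finset.range j, ∑ i, (D t i).indicator (fun _ => (1 : ENNReal)) ω := by
    intro ω
    have hstep : ∀ t ∈ Finset.range j,
        {ω | IsSuboptimal lam (A (t + 1) ω)}.indicator (fun _ => (1 : ENNReal)) ω ≤
          ((∑ i, if i ∈ A (t + 1) ω ∧ pullCount A i t ω < m then 1 else 0 : ℕ) : ENNReal) +
            ∑ i, (D t i).indicator (fun _ => (1 : ENNReal)) ω := by
      intro t ht
      by_cases h : IsSuboptimal lam (A (t + 1) ω)
      · rw [Set.indicator_of_mem (by exact h)]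
        rcases exists_pullCount_lt_or_mem_deviation hlam hT0 hA (Finset.mem_range.1 ht) hjT hm hm' h
          with ⟨i, hi⟩ | ⟨i, hi⟩
        · refine le_add_right ?_
          have := Finset.single_le_sum
            (f := fun i => if i ∈ A (t + 1) ω ∧ pullCount A i t ω < m then 1 else 0)
            (fun _ _ => Nat.zero_le _) (Finset.mem_univ i)
          rw [if_pos hi] at this
          exact_mod_cast this
        · refine le_add_left ?_
          have := Finset.single_le_sum
            (f := fun i => (D t i).indicator (fun _ => (1 : ENNReal)) ω)
            (fun _ _ => zero_le) (Finset.mem_univ i)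
          rwa [Set.indicator_of_mem hi] at this
      · rw [Set.indicator_of_notMem (by exact h)]
        exact zero_le
    refine (Finset.sum_le_sum hstep).trans ?_
    rw [Finset.sum_add_distrib, ← Nat.cast_sum, Finset.sum_comm]
    simp_rw [sum_employed_pullCount_lt]
    gcongr
    calc ∑ i, min (pullCount A i j ω) m ≤ ∑ _i : Fin n, m :=
          Finset.sum_le_sum fun i _ => min_le_right _ _
      _ = n * m := by simp
  have hzeta : ∑ t ∈ Finset.range j, 2 * (1 / (t : ℝ) ^ 2) ≤ Real.pi ^ 2 / 3 := by
    have := sum_le_hasSum (Finset.range j) (fun t _ => by positivity) hasSum_zeta_two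
    rw [← Finset.mul_sum]
    linarith
  have hENN : ∑ t ∈ Finset.range j, P {ω | IsSuboptimal lam (A (t + 1) ω)} ≤
      ENNReal.ofReal (n * (m + Real.pi ^ 2 / 3)) := by
    calc ∑ t ∈ Finset.range j, P {ω | IsSuboptimal lam (A (t + 1) ω)}
        = ∫⁻ ω, ∑ t ∈ Finset.range j,
            {ω | IsSuboptimal lam (A (t + 1) ω)}.indicator (fun _ => (1 : ENNReal)) ω ∂P := by
          rw [lintegral_finsetSum' _ fun t ht =>
            (measurable_const.indicator (hSm t ht)).aemeasurable]
          exact Finset.sum_congr rfl fun t ht => by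
            rw [lintegral_indicator_const (hSm t ht), one_mul]
      _ ≤ ∫⁻ ω, (((n * m : ℕ) : ENNReal) +
            ∑ t ∈ Finset.range j, ∑ i, (D t i).indicator (fun _ => (1 : ENNReal)) ω) ∂P :=
          lintegral_mono hpoint
      _ = ((n * m : ℕ) : ENNReal) + ∑ t ∈ Finset.range j, ∑ i, P (D t i) := by
          rw [lintegral_add_left measurable_const, lintegral_const, measure_univ, mul_one,
            lintegral_finsetSum' _ fun t ht => (Finset.measurable_sum _ fun i _ =>
              measurable_const.indicator (hDm t ht i)).aemeasurable]
          congr 1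
          refine Finset.sum_congr rfl fun t ht => ?_
          rw [lintegral_finsetSum _ fun i _ => measurable_const.indicator (hDm t ht i)]
          exact Finset.sum_congr rfl fun i _ => by
            rw [lintegral_indicator_const (hDm t ht i), one_mul]
      _ ≤ ((n * m : ℕ) : ENNReal) +
            ∑ t ∈ Finset.range j, ∑ _i : Fin n, ENNReal.ofReal (2 * (1 / (t : ℝ) ^ 2)) := by
          gcongr with t ht i
          exact measure_deviation_le hX hA.predictable hlam i
            ((Finset.mem_range.1 ht).le.trans hjT)
      _ = ENNReal.ofReal (n * (m + ∑ t ∈ Finset.range j, 2 * (1 / (t : ℝ) ^ 2))) := by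
          rw [mul_add, ENNReal.ofReal_add (by positivity) (by positivity)]
          congr 1
          · rw [← ENNReal.ofReal_natCast]; push_cast; rfl
          · simp only [Finset.sum_const, Finset.card_univ, Fintype.card_fin, nsmul_eq_mul]
            rw [← Finset.mul_sum, ENNReal.ofReal_mul (by positivity), ENNReal.ofReal_natCast,
              ENNReal.ofReal_sum_of_nonneg fun t _ => by positivity]
      _ ≤ ENNReal.ofReal (n * (m + Real.pi ^ 2 / 3)) := by
          gcongr
  have hreal : ∑ t ∈ Finset.range j, P.real {ω | IsSuboptimal lam (A (t + 1) ω)} =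
      (∑ t ∈ Finset.range j, P {ω | IsSuboptimal lam (A (t + 1) ω)}).toReal := by
    rw [ENNReal.toReal_sum fun t _ => measure_ne_top P _]
    rfl
  rw [hreal]
  exact ENNReal.toReal_le_of_le_ofReal (by positivity) hENN

end Counting

end CMAB

/-! ### The regret bound. -/

theorem theorem1 {Ω : Type*} {mΩ : MeasurableSpace Ω} (P : Measure Ω) [IsProbabilityMeasure P]
    (ℱ : Filtration ℕ mΩ) (n b : ℕ) (hb : b ≤ n) (T : ℕ → ℕ) (hT0 : T 0 = 0)
    (hT : MonotoneOn T (Set.Icc 0 b)) (lam : Fin n → ℝ) (hlam : ∀ i, 1 ≤ lam i)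
    (X : ℕ → Fin n → Ω → ℝ) (hX : CMAB.IsResponseModel P ℱ lam X)
    (A : ℕ → Ω → Finset (Fin n)) (hA : CMAB.IsLCBPolicy ℱ b T CMAB.confRadius X A)
    (j : ℕ) (hj : 1 ≤ j) (hjT : j ≤ T b) :
    Integrable (CMAB.runTime X A j) P ∧
    CMAB.regret P lam b T X A j ≤
      CMAB.maxSuperarmGap lam b T j * n *
        (48 * Real.log j / min (CMAB.gapMin lam b ^ 2) (CMAB.gapMin lam b) + 1 +
          CMAB.maxActive b T j * (Real.pi ^ 2 / 3)) := by
  open CMAB in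
  have hpos : ∀ i, 0 < lam i := fun i => by linarith [hlam i]
  have hint : ∀ y ∈ Finset.Icc 1 j,
      Integrable (fun ω => responseTime (fun i => X y i ω) (A y ω)) P := by
    intro y hy
    obtain ⟨h1, h2⟩ := Finset.mem_Icc.1 hy
    obtain ⟨t, rfl⟩ := Nat.exists_eq_add_of_le' h1
    exact hX.integrable_responseTime_superarm hpos t
      fun S => ℱ.le t _ (hA.predictable t (by omega) S)
  refine ⟨integrable_finsetSum _ hint, ?_⟩
  set G := maxSuperarmGap lam b T j with hG
  set ℓ := 48 * Real.log j / min (gapMin lam b ^ 2) (gapMin lam b) with hℓ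
  have hb1 : 1 ≤ b := by
    by_contra h
    have : b = 0 := by omega
    rw [this, hT0] at hjT
    omega
  -- An active round yields both `0 ≤ G` and `1 ≤ maxActive b T j`.
  have hone : 1 ∈ activeRounds b T j := by
    simp only [activeRounds, Finset.mem_filter, Finset.mem_Icc, Nat.sub_self, hT0]
    omega
  have hgap : ∀ r ∈ activeRounds b T j, superarmGapMax lam r ≤ G := fun r hr =>
    le_csSup (((activeRounds b T j).finite_toSet.image _).bddAbove) ⟨r, hr, rfl⟩
  have hG0 : 0 ≤ G := (superarmGapMax_nonneg hpos (hb1.trans hb)).trans (hgap 1 hone)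
  have hu : (1 : ℝ) ≤ maxActive b T j := by
    have : 1 ≤ maxActive b T j := Finset.le_sup (f := id) hone
    exact_mod_cast this
  have hℓ0 : 0 ≤ ℓ := by
    have := Real.log_natCast_nonneg j
    have := gapMin_nonneg (lam := lam) b
    positivity
  -- The maximum with `1` ensures that a worker counted as explored has a finite bound; rounding up
  -- is paid for by the `+ 1` in the theorem.
  set m := max 1 ⌈ℓ⌉₊ with hm
  have hmle : (m : ℝ) ≤ ℓ + 1 := by
    rw [hm, Nat.cast_max, max_le_iff]
    exact ⟨by simpa using hℓ0, (Nat.ceil_lt_add_one hℓ0).le⟩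
  have hcount := sum_measure_isSuboptimal_le hX hlam hT0 hA hjT (m := m) (le_max_left _ _)
    ((Nat.le_ceil _).trans (by exact_mod_cast le_max_right 1 ⌈ℓ⌉₊))
  have hregret : regret P lam b T X A j = ∑ r ∈ activeRounds b T j,
      ∑ y ∈ Finset.Ioc (T (r - 1)) (min j (T r)),
        (∫ ω, responseTime (fun i => X y i ω) (A y ω) ∂P - bestMean lam r) := by
    unfold regret runTime
    rw [integral_finsetSum _ hint, sum_Icc_eq_sum_activeRounds hT0 hT hjT,
      ← Finset.sum_sub_distrib]
    refine Finset.sum_congr rfl fun r hr => ?_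
    simp only [activeRounds, Finset.mem_filter, Finset.mem_Icc] at hr
    have hmono : T (r - 1) ≤ T r := hT ⟨by omega, by omega⟩ ⟨by omega, by omega⟩ (by omega)
    rw [Finset.sum_sub_distrib, Finset.sum_const, Nat.card_Ioc, nsmul_eq_mul,
      Nat.cast_sub (le_min hr.2.le hmono)]
  have hshift : ∑ y ∈ Finset.Icc 1 j, P.real {ω | IsSuboptimal lam (A y ω)} =
      ∑ t ∈ Finset.range j, P.real {ω | IsSuboptimal lam (A (t + 1) ω)} := by
    rw [Finset.range_eq_Ico, Finset.sum_Ico_add' (fun y => P.real {ω | IsSuboptimal lam (A y ω)})]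
    rfl
  calc regret P lam b T X A j
      ≤ ∑ r ∈ activeRounds b T j, ∑ y ∈ Finset.Ioc (T (r - 1)) (min j (T r)),
          G * P.real {ω | IsSuboptimal lam (A y ω)} := by
        rw [hregret]
        refine Finset.sum_le_sum fun r hr => Finset.sum_le_sum fun y hy => ?_
        obtain ⟨h1, h2⟩ := Finset.mem_Ioc.1 hy
        obtain ⟨t, rfl⟩ := Nat.exists_eq_add_of_le' (show 1 ≤ y by omega)
        have hr' := (Finset.mem_filter.1 hr).1
        refine (hX.integral_responseTime_sub_bestMean_le hpos t
          (hA.predictable t (by omega))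
          (hA.card_eq r hr' (t + 1) h1 (h2.trans (min_le_right _ _)))).trans ?_
        exact mul_le_mul_of_nonneg_right (hgap r hr) measureReal_nonneg
    _ = G * ∑ t ∈ Finset.range j, P.real {ω | IsSuboptimal lam (A (t + 1) ω)} := by
        rw [← sum_Icc_eq_sum_activeRounds hT0 hT hjT, ← Finset.mul_sum, hshift]
    _ ≤ G * (n * (m + Real.pi ^ 2 / 3)) := mul_le_mul_of_nonneg_left hcount hG0
    -- The count above needs no factor `maxActive b T j`; since it is at least one, inserting it
    -- only weakens the bound.
    _ ≤ G * (n * (ℓ + 1 + maxActive b T j * (Real.pi ^ 2 / 3))) := by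
        have : 0 ≤ Real.pi ^ 2 / 3 := by positivity
        gcongr
        exact le_mul_of_one_le_left this hu
    _ = G * n * (ℓ + 1 + maxActive b T j * (Real.pi ^ 2 / 3)) := by ring
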